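/- Let $l\ge n\ge 0$ be integers and let $x_1<x_2<\dots<x_{n+1}<t_{l+1}<\dots<t_2<t_1$ be real numbers. Let $A=(a_{i,j})$ be the $(l+1)\times(n+1)$ Lagrange--Vandermonde matrix with entries $$a_{i,j}=\prod_{\substack{k=1\\ k\ne j}}^{n+1}(t_i-x_k),\qquad 1\le i\le l+1,\ 1\le j\le n+1.$$ Recall the Neville elimination of an $r\times c$ matrix $B$: set $B^{(1)}=B$ and process the columns $j=1,2,\dots,c$ in turn. Let $\widetilde B^{(j)}$ be obtained from $B^{(j)}$ by moving to the bottom, if there are any, the rows of index $\ge j$ that have a zero entry in column $j$ (keeping the order otherwise). The pivots are $p_{i,j}=\widetilde b^{(j)}_{i,j}$ ($j\le i\le r$), those with $i=j$ being the diagonal pivots, and the multipliers are $m_{i,j}=p_{i,j}/p_{i-1,j}$ ($j<i\le r$), with $m_{i,j}=0$ if $p_{i-1,j}=0$. The matrix $B^{(j+1)}$ is obtained from $\widetilde B^{(j)}$ by subtracting from each row $i>j$ the multiple $m_{i,j}$ of row $i-1$ of $\widetilde B^{(j)}$. Then $A$ is strictly totally positive, that is, all its minors are positive, and $$A=F_lF_{l-1}\cdots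 F_1\,D\,G_1\cdots G_{n-1}G_n,$$ where - $F_i$ ($1\le i\le l$) is the $(l+1)\times(l+1)$ lower bidiagonal matrix with unit diagonal whose subdiagonal entry in row $q$ (position $(q,q-1)$) is $m_{q,q-i}$ for $i+1\le q\le l+1$, and $0$ for $2\le q\le i$; - $G_i^T$ ($1\le i\le n$) is the $(n+1)\times(n+1)$ lower bidiagonal matrix with unit diagonal whose subdiagonal entry in row $q$ is $\widetilde m_{q,q-i}$ for $i+1\le q\le n+1$, and $0$ for $2\le q\le i$; - $D$ is the $(l+1)\times(n+1)$ diagonal matrix $\mathrm{diag}\{p_{1,1},\dots,p_{n+1,n+1}\}$. Here $m_{i,j}$ and $\widetilde m_{i,j}$ are the multipliers of the Neville elimination of $A$ and of $A^T$, respectively (with $m_{i,j}=0$ for $j>n+1$), and $p_{i,i}$ are the diagonal pivots of the Neville elimination of $A$. They are given by $$m_{i,j}=(t_{i-j}-x_j)\,\frac{\prod_{k=i-j+1}^{i-1}(t_i-t_k)\ \prod_{k=j+1}^{n+1}(t_i-x_k)}{\prod_{k=i-j}^{i-2}(t_{i-1}-t_k)\ \prod_{k=j}^{n+1}(t_{i-1}-x_k)},\qquad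 1\le j\le n+1,\ j+1\le i\le l+1,$$ $$\widetilde m_{i,j}=(t_j-x_{i-j})\,\frac{\prod_{k=i-j+1}^{i-1}(x_i-x_k)\ \prod_{k=1}^{j-1}(t_k-x_{i-1})}{\prod_{k=i-j}^{i-2}(x_{i-1}-x_k)\ \prod_{k=1}^{j}(t_k-x_i)},\qquad 1\le j\le n,\ j+1\le i\le n+1,$$ $$p_{i,i}=\frac{\prod_{k=1}^{i-1}(t_k-t_i)\ \prod_{k=1}^{i-1}(x_i-x_k)\ \prod_{k=i+1}^{n+1}(t_i-x_k)}{\prod_{k=1}^{i-1}(t_k-x_i)},\qquad 1\le i\le n+1.$$ Empty products equal $1$. -/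

import Mathlib

noncomputable section

namespace LagrangeVandermonde

/-- A real matrix is strictly totally positive if all its minors are positive. -/
def IsSTP {r c : ℕ} (A : Matrix (Fin r) (Fin c) ℝ) : Prop :=
  ∀ (k : ℕ) (f : Fin k ↪o Fin r) (g : Fin k ↪o Fin c), 0 < (A.submatrix f g).det

/-- The `(l+1) × (n+1)` Lagrange-Vandermonde matrix: the entry in (1-based) row `i` and column `j`
is `∏_{1 ≤ k ≤ n+1, k ≠ j} (t_i - x_k)`. The nodes `x_1, …, x_{n+1}` and `t_1, …, t_{l+1}` are
the values of `x` and `t` at `1, …, n+1` and `1, …, l+1`. -/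
def lagrangeVandermonde (l n : ℕ) (x t : ℕ → ℝ) : Matrix (Fin (l + 1)) (Fin (n + 1)) ℝ :=
  Matrix.of fun i j => ∏ k ∈ (Finset.Icc 1 (n + 1)).erase (j.val + 1), (t (i.val + 1) - x k)

/-- Row moves before the elimination in column `k`: among the rows from the diagonal on
(`k ≤ i`), those with a zero entry in column `k` are moved to the bottom. The order is
otherwise kept (`Tuple.sort` is stable). -/
def nevilleReorder {r c : ℕ} (k : Fin c) (B : Matrix (Fin r) (Fin c) ℝ) :
    Matrix (Fin r) (Fin c) ℝ :=
  B.submatrix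
    (Tuple.sort fun i : Fin r => if k.val ≤ i.val ∧ B i k = 0 then (1 : ℕ) else 0) id

/-- Elimination in column `k`: from every row below the diagonal, subtract the multiple of the
preceding row that produces a zero in column `k`. Nothing is subtracted where the entry of the
preceding row is zero (the quotient is then `0`). -/
def nevilleEliminate {r c : ℕ} (k : Fin c) (B : Matrix (Fin r) (Fin c) ℝ) :
    Matrix (Fin r) (Fin c) ℝ :=
  Matrix.of fun i j =>
    if k.val < i.val then
      B i j - B i k / B ⟨i.val - 1, by omega⟩ k * B ⟨i.val - 1, by omega⟩ j
    else B i j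

/-- The matrices of the Neville elimination of `A`: `nevilleStage A k` is the matrix obtained
after the columns `1, …, k` have been processed. -/
def nevilleStage {r c : ℕ} (A : Matrix (Fin r) (Fin c) ℝ) : ℕ → Matrix (Fin r) (Fin c) ℝ
  | 0 => A
  | k + 1 =>
    if h : k < c then nevilleEliminate ⟨k, h⟩ (nevilleReorder ⟨k, h⟩ (nevilleStage A k))
    else nevilleStage A k

/-- The pivot `p_{i,j}` (1-based indices, `1 ≤ j ≤ i ≤ r`, `j ≤ c`) of the Neville elimination
of `A`: the `(i,j)` entry after the row moves for column `j`. It is `0` outside that range. -/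
def nevillePivot {r c : ℕ} (A : Matrix (Fin r) (Fin c) ℝ) (i j : ℕ) : ℝ :=
  if h : 1 ≤ j ∧ j ≤ i ∧ i ≤ r ∧ j ≤ c then
    nevilleReorder ⟨j - 1, by omega⟩ (nevilleStage A (j - 1)) ⟨i - 1, by omega⟩ ⟨j - 1, by omega⟩
  else 0

/-- The multiplier `m_{i,j} = p_{i,j} / p_{i-1,j}` (1-based indices, `1 ≤ j < i ≤ r`, `j ≤ c`)
of the Neville elimination of `A`; it is `0` if `p_{i-1,j} = 0`, and outside that range. -/
def nevilleMultiplier {r c : ℕ} (A : Matrix (Fin r) (Fin c) ℝ) (i j : ℕ) : ℝ :=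
  if j < i then nevillePivot A i j / nevillePivot A (i - 1) j else 0

/-- The `N × N` lower bidiagonal matrix with unit diagonal whose subdiagonal entry in (1-based)
row `q` is `m_{q,q-i}` for `q = i+1, …, N` and `0` for `q ≤ i`. -/
def bidiagonal (N : ℕ) (m : ℕ → ℕ → ℝ) (i : ℕ) : Matrix (Fin N) (Fin N) ℝ :=
  Matrix.of fun a b =>
    if a = b then 1
    else if a.val = b.val + 1 ∧ i ≤ a.val then m (a.val + 1) (a.val + 1 - i)
    else 0

/-- The `r × c` diagonal matrix with diagonal entries `p_1, p_2, …`. -/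
def rectDiagonal (r c : ℕ) (p : ℕ → ℝ) : Matrix (Fin r) (Fin c) ℝ :=
  Matrix.of fun a b => if a.val = b.val then p (a.val + 1) else 0

/-- The product `F_l F_{l-1} ⋯ F_1`. -/
def prodDown {N : ℕ} (F : ℕ → Matrix (Fin N) (Fin N) ℝ) (l : ℕ) : Matrix (Fin N) (Fin N) ℝ :=
  ((List.range l).reverse.map fun k => F (k + 1)).prod

/-- The product `G_1 G_2 ⋯ G_n`. -/
def prodUp {N : ℕ} (G : ℕ → Matrix (Fin N) (Fin N) ℝ) (n : ℕ) : Matrix (Fin N) (Fin N) ℝ :=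
  ((List.range n).map fun k => G (k + 1)).prod

end LagrangeVandermonde

end

namespace LagrangeVandermonde

open Finset

/-! ### Neville elimination without row exchanges -/

/-! Restoring the missing factor `t_i - x_j` writes each entry as `ω(t_i) / (t_i - x_j)`, where `ω`
is the nodal polynomial of the `x_k`. So `A` is a Cauchy matrix with scaled rows. Matrices with
entries `w_i v_j / (a_i - b_j)` are closed under taking submatrices and, after negating the nodes,
under transposition.

For this class every stage of Neville elimination is explicit: `cauchyStage` is what the Cauchy
determinant formula gives for the minor on rows `i-k, …, i` and columns `0, …, k-1, j`, divided by
the one on rows `i-k, …, i-1` and columns `0, …, k-1`. `CauchyData.stage_succ` verifies the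
recursion directly. No pivot vanishes, so rows never move.

Three consequences follow. A square matrix of the class has as determinant the product of its
diagonal pivots, positive for ordered nodes, so all minors of `A` are positive. Undoing the
eliminations of `A` and of its transpose gives two triangular factorizations, which
`upper_eq_rectDiagonal_mul` merges into the bidiagonal one. Multipliers and pivots are read off the
closed form. -/

/-- The pivots of the Neville elimination of `A` in every column do not vanish, before any row
moves. -/
def NevilleRegular {r c : ℕ} (A : Matrix (Fin r) (Fin c) ℝ) : Prop :=
  ∀ (k : Fin c) (i : Fin r), k.val ≤ i.val → nevilleStage A k i k ≠ 0

theorem nevilleReorder_eq_self {r c : ℕ} {k : Fin c} {B : Matrix (Fin r) (Fin c) ℝ}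
    (h : ∀ i : Fin r, k.val ≤ i.val → B i k ≠ 0) : nevilleReorder k B = B := by
  have hs : (fun i : Fin r => if k.val ≤ i.val ∧ B i k = 0 then (1 : ℕ) else 0) = fun _ => 0 := by
    funext i
    rw [if_neg]
    rintro ⟨h1, h2⟩
    exact h i h1 h2
  have hm : Tuple.sort (fun _ : Fin r => (0 : ℕ)) = Equiv.refl _ :=
    Tuple.sort_eq_refl_iff_monotone.2 monotone_const
  rw [nevilleReorder, hs, hm]
  rfl

theorem NevilleRegular.stage_succ {r c : ℕ} {A : Matrix (Fin r) (Fin c) ℝ}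
    (hA : NevilleRegular A) {k : ℕ} (hk : k < c) :
    nevilleStage A (k + 1) = nevilleEliminate ⟨k, hk⟩ (nevilleStage A k) := by
  rw [nevilleStage, dif_pos hk, nevilleReorder_eq_self (hA ⟨k, hk⟩)]

theorem NevilleRegular.pivot_eq {r c : ℕ} {A : Matrix (Fin r) (Fin c) ℝ}
    (hA : NevilleRegular A) {i k : ℕ} (hki : k ≤ i) (hi : i < r) (hk : k < c) :
    nevillePivot A (i + 1) (k + 1) = nevilleStage A k ⟨i, hi⟩ ⟨k, hk⟩ := by
  have h : 1 ≤ k + 1 ∧ k + 1 ≤ i + 1 ∧ i + 1 ≤ r ∧ k + 1 ≤ c := by omega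
  rw [nevillePivot, dif_pos h]
  simp only [Nat.add_sub_cancel]
  rw [nevilleReorder_eq_self (hA ⟨k, hk⟩)]

/-- Each elimination step adds the multiple of the preceding row back. -/
theorem NevilleRegular.stage_eq_add {r c : ℕ} {A : Matrix (Fin r) (Fin c) ℝ}
    (hA : NevilleRegular A) {q k : ℕ} (hq : q + 1 < r) (hkq : k ≤ q) (j : Fin c) :
    nevilleStage A k ⟨q + 1, hq⟩ j = nevilleStage A (k + 1) ⟨q + 1, hq⟩ j +
      nevilleMultiplier A (q + 2) (k + 1) * nevilleStage A k ⟨q, by omega⟩ j := by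
  by_cases hk : k < c
  · rw [hA.stage_succ hk, nevilleMultiplier, if_pos (by omega), show q + 2 - 1 = q + 1 by omega,
      hA.pivot_eq (by omega) hq hk, hA.pivot_eq hkq (by omega) hk]
    simp only [nevilleEliminate, Matrix.of_apply]
    rw [if_pos (by omega)]
    simp
  -- Past the last column the stage no longer changes, and the multiplier is `0` because its pivot
  -- is out of range.
  · have h1 : nevillePivot A (q + 2) (k + 1) = 0 := by
      rw [nevillePivot, dif_neg (by omega)]
    rw [nevilleMultiplier, if_pos (by omega), h1, nevilleStage, dif_neg hk]
    simp

/-- The upper trapezoidal matrix at the end of the Neville elimination. -/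
noncomputable def nevilleUpper {r c : ℕ} (A : Matrix (Fin r) (Fin c) ℝ) :
    Matrix (Fin r) (Fin c) ℝ :=
  Matrix.of fun i j => nevilleStage A i i j

theorem bidiagonal_mul_apply_zero {N c : ℕ} (m : ℕ → ℕ → ℝ) (i : ℕ)
    (B : Matrix (Fin N) (Fin c) ℝ) (h : 0 < N) (j : Fin c) :
    (bidiagonal N m i * B) ⟨0, h⟩ j = B ⟨0, h⟩ j := by
  rw [Matrix.mul_apply, Finset.sum_eq_single ⟨0, h⟩]
  · simp [bidiagonal]
  · intro b _ hb
    simp [bidiagonal, hb.symm]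
  · simp

theorem bidiagonal_mul_apply_succ {N c : ℕ} (m : ℕ → ℕ → ℝ) (i : ℕ)
    (B : Matrix (Fin N) (Fin c) ℝ) {q : ℕ} (h : q + 1 < N) (j : Fin c) :
    (bidiagonal N m i * B) ⟨q + 1, h⟩ j = B ⟨q + 1, h⟩ j +
      (if i ≤ q + 1 then m (q + 2) (q + 2 - i) else 0) * B ⟨q, by omega⟩ j := by
  have hne : (⟨q + 1, h⟩ : Fin N) ≠ ⟨q, by omega⟩ := by simp
  rw [Matrix.mul_apply, Finset.sum_eq_add (⟨q + 1, h⟩ : Fin N) ⟨q, by omega⟩ hne]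
  · simp [bidiagonal]
  · intro b _ hb
    have h1 : (⟨q + 1, h⟩ : Fin N) ≠ b := hb.1.symm
    have h2 : q ≠ b.val := fun e => hb.2 (Fin.ext e.symm)
    simp [bidiagonal, h1, h2]
  · simp
  · simp

theorem prodDown_succ {N : ℕ} (F : ℕ → Matrix (Fin N) (Fin N) ℝ) (l : ℕ) :
    prodDown F (l + 1) = F (l + 1) * prodDown F l := by
  simp [prodDown, List.range_succ]

theorem transpose_prodDown {N : ℕ} (F : ℕ → Matrix (Fin N) (Fin N) ℝ) (l : ℕ) :
    (prodDown F l).transpose = prodUp (fun i => (F i).transpose) l := by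
  rw [prodDown, prodUp, Matrix.transpose_list_prod]
  simp [List.map_reverse, Function.comp_def]

/-- The partial products `F_i ⋯ F_1 U` have the row `q` of the stage `q - i` of the elimination
as their row `q`. -/
theorem NevilleRegular.prodDown_mul_upper_apply {r c : ℕ} {A : Matrix (Fin r) (Fin c) ℝ}
    (hA : NevilleRegular A) (i : ℕ) (q : Fin r) (j : Fin c) :
    (prodDown (fun i => bidiagonal r (nevilleMultiplier A) i) i * nevilleUpper A) q j =
      nevilleStage A (q.val - i) q j := by
  induction i generalizing q with
  | zero => simp [prodDown, nevilleUpper]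
  | succ i ih =>
    rw [prodDown_succ, Matrix.mul_assoc]
    obtain ⟨q, hq⟩ := q
    cases q with
    | zero => rw [bidiagonal_mul_apply_zero, ih]; simp
    | succ q =>
      rw [bidiagonal_mul_apply_succ, ih, ih]
      by_cases h : i + 1 ≤ q + 1
      · rw [if_pos h, show q + 2 - (i + 1) = (q - i) + 1 by omega]
        -- On row `q + 1` the new factor undoes the elimination step in column `q - i`. The row `q`
        -- it adds is at stage `q - i`, as that step requires.
        have := hA.stage_eq_add hq (show q - i ≤ q by omega) j
        rw [show q + 1 - i = (q - i) + 1 by omega, show q + 1 - (i + 1) = q - i by omega]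
        exact this.symm
      · rw [if_neg h]
        simp only [zero_mul, add_zero]
        rw [show q + 1 - i = 0 by omega, show q + 1 - (i + 1) = 0 by omega]

/-- Row `q` needs only `q` steps undone; with `l ≥ r - 1` factors all rows are back at stage `0`. -/
theorem NevilleRegular.eq_prodDown_mul_upper {r c l : ℕ} {A : Matrix (Fin r) (Fin c) ℝ}
    (hA : NevilleRegular A) (hl : r ≤ l + 1) :
    A = prodDown (fun i => bidiagonal r (nevilleMultiplier A) i) l * nevilleUpper A := by
  ext q j
  rw [hA.prodDown_mul_upper_apply, show q.val - l = 0 by omega]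
  rfl

/-- Zeros made in earlier columns survive: when column `k` is processed, the subtracted row has
index at least `k`, so it already vanishes in every column before `k`. -/
theorem NevilleRegular.stage_eq_zero {r c : ℕ} {A : Matrix (Fin r) (Fin c) ℝ}
    (hA : NevilleRegular A) {k : ℕ} (i : Fin r) (j : Fin c) (hji : j.val < i.val)
    (hjk : j.val < k) : nevilleStage A k i j = 0 := by
  induction k generalizing i with
  | zero => omega
  | succ k ih =>
    by_cases hk : k < c
    · obtain ⟨i, hi⟩ := i
      obtain ⟨j, hj⟩ := j
      rw [hA.stage_succ hk]
      simp only [nevilleEliminate, Matrix.of_apply] at hji hjk ih ⊢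
      obtain rfl | hlt : j = k ∨ j < k := by omega
      · rw [if_pos hji, div_mul_cancel₀, sub_self]
        exact hA ⟨j, hj⟩ ⟨i - 1, by omega⟩ (by simp only; omega)
      · split_ifs with h
        · rw [ih ⟨i, hi⟩ hji hlt, ih ⟨i - 1, by omega⟩ (by simp only; omega) hlt]
          simp
        · exact ih ⟨i, hi⟩ hji hlt
    · rw [nevilleStage, dif_neg hk]
      exact ih i hji (by omega)

theorem NevilleRegular.upper_eq_zero {r c : ℕ} {A : Matrix (Fin r) (Fin c) ℝ}
    (hA : NevilleRegular A) (i : Fin r) (j : Fin c) (h : j.val < i.val) :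
    nevilleUpper A i j = 0 :=
  hA.stage_eq_zero i j h h

/-! ### Unit lower triangular matrices -/

/-- A square matrix is unit lower triangular if it agrees with the identity on and above the
diagonal. -/
def IsUnitLower {N : ℕ} (M : Matrix (Fin N) (Fin N) ℝ) : Prop :=
  ∀ i j, i ≤ j → M i j = (1 : Matrix (Fin N) (Fin N) ℝ) i j

theorem IsUnitLower.apply_self {N : ℕ} {M : Matrix (Fin N) (Fin N) ℝ} (hM : IsUnitLower M)
    (i : Fin N) : M i i = 1 := by
  rw [hM i i le_rfl, Matrix.one_apply_eq]

theorem IsUnitLower.apply_of_lt {N : ℕ} {M : Matrix (Fin N) (Fin N) ℝ} (hM : IsUnitLower M)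
    {i j : Fin N} (h : i < j) : M i j = 0 := by
  rw [hM i j h.le, Matrix.one_apply_ne h.ne]

theorem IsUnitLower.blockTriangular {N : ℕ} {M : Matrix (Fin N) (Fin N) ℝ} (hM : IsUnitLower M) :
    M.BlockTriangular OrderDual.toDual :=
  fun _ _ h => hM.apply_of_lt h

theorem IsUnitLower.det_eq_one {N : ℕ} {M : Matrix (Fin N) (Fin N) ℝ} (hM : IsUnitLower M) :
    M.det = 1 := by
  rw [Matrix.det_of_isLowerTriangular _ hM.blockTriangular]
  exact Finset.prod_eq_one fun i _ => hM.apply_self i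

theorem IsUnitLower.isUnit_det {N : ℕ} {M : Matrix (Fin N) (Fin N) ℝ} (hM : IsUnitLower M) :
    IsUnit M.det := by
  rw [hM.det_eq_one]
  exact isUnit_one

theorem IsUnitLower.inv_apply_of_lt {N : ℕ} {M : Matrix (Fin N) (Fin N) ℝ} (hM : IsUnitLower M)
    {i j : Fin N} (h : i < j) : M⁻¹ i j = 0 := by
  have := Matrix.invertibleOfIsUnitDet M hM.isUnit_det
  exact Matrix.blockTriangular_inv_of_blockTriangular hM.blockTriangular h

theorem IsUnitLower.mul {N : ℕ} {M M' : Matrix (Fin N) (Fin N) ℝ} (hM : IsUnitLower M)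
    (hM' : IsUnitLower M') : IsUnitLower (M * M') := by
  intro i j hij
  rw [Matrix.mul_apply, Finset.sum_eq_single i, hM.apply_self, hM' i j hij, one_mul]
  · intro k _ hk
    rcases lt_or_gt_of_ne hk with h | h
    · rw [hM'.apply_of_lt (h.trans_le hij), mul_zero]
    · rw [hM.apply_of_lt h, zero_mul]
  · simp

theorem isUnitLower_bidiagonal (N : ℕ) (m : ℕ → ℕ → ℝ) (i : ℕ) :
    IsUnitLower (bidiagonal N m i) := by
  intro a b hab
  have h : ¬ (a.val = b.val + 1 ∧ i ≤ a.val) := by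
    have : a.val ≤ b.val := hab
    omega
  simp [bidiagonal, Matrix.one_apply, h]

theorem isUnitLower_prodDown (N : ℕ) (m : ℕ → ℕ → ℝ) (l : ℕ) :
    IsUnitLower (prodDown (fun i => bidiagonal N m i) l) := by
  induction l with
  | zero => intro i j _; simp [prodDown]
  | succ l ih => rw [prodDown_succ]; exact (isUnitLower_bidiagonal N m _).mul ih

/-- Uniqueness of the triangular factorization: if `L U = Vᵀ Gᵀ` with unit lower triangular
`L`, `G` and upper trapezoidal `U`, `V`, then `U` is the diagonal of `U` times `Gᵀ`. -/
theorem upper_eq_rectDiagonal_mul {r c : ℕ} {L : Matrix (Fin r) (Fin r) ℝ}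
    {G : Matrix (Fin c) (Fin c) ℝ} {U : Matrix (Fin r) (Fin c) ℝ} {V : Matrix (Fin c) (Fin r) ℝ}
    (hL : IsUnitLower L) (hG : IsUnitLower G)
    (hU : ∀ (i : Fin r) (j : Fin c), j.val < i.val → U i j = 0)
    (hV : ∀ (i : Fin c) (j : Fin r), j.val < i.val → V i j = 0)
    (h : L * U = (G * V).transpose) {p : ℕ → ℝ}
    (hp : ∀ (i : Fin r) (j : Fin c), i.val = j.val → U i j = p (i.val + 1)) :
    U = rectDiagonal r c p * G.transpose := by
  -- `E` also equals `U (G⁻¹)ᵀ`. The first form makes it vanish above the diagonal and the second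
  -- below, so it is diagonal.
  obtain ⟨E, hE⟩ : ∃ E, E = L⁻¹ * V.transpose := ⟨_, rfl⟩
  have hUE : U = E * G.transpose := by
    rw [hE, Matrix.mul_assoc, ← Matrix.transpose_mul, ← h,
      Matrix.nonsing_inv_mul_cancel_left _ _ hL.isUnit_det]
  have hEU : E = U * (G⁻¹).transpose := by
    rw [hUE, Matrix.mul_assoc, ← Matrix.transpose_mul, Matrix.nonsing_inv_mul _ hG.isUnit_det,
      Matrix.transpose_one, Matrix.mul_one]
  have hE1 : ∀ (i : Fin r) (j : Fin c), i.val < j.val → E i j = 0 := by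
    intro i j hij
    rw [hE, Matrix.mul_apply]
    refine Finset.sum_eq_zero fun k _ => ?_
    rcases lt_or_ge i k with hk | hk
    · rw [hL.inv_apply_of_lt hk, zero_mul]
    · have : k.val ≤ i.val := hk
      rw [Matrix.transpose_apply, hV j k (by omega), mul_zero]
  have hE2 : ∀ (i : Fin r) (j : Fin c), j.val < i.val → E i j = 0 := by
    intro i j hij
    rw [hEU, Matrix.mul_apply]
    refine Finset.sum_eq_zero fun k _ => ?_
    rcases lt_or_ge j k with hk | hk
    · rw [Matrix.transpose_apply, hG.inv_apply_of_lt hk, mul_zero]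
    · have : k.val ≤ j.val := hk
      rw [hU i k (by omega), zero_mul]
  have hE3 : ∀ (i : Fin r) (j : Fin c), i.val = j.val → E i j = U i j := by
    intro i j hij
    rw [hUE, Matrix.mul_apply, Finset.sum_eq_single j, Matrix.transpose_apply, hG.apply_self,
      mul_one]
    · intro k _ hk
      have : k.val ≠ j.val := fun e => hk (Fin.ext e)
      rcases lt_or_gt_of_ne this with hlt | hlt
      · rw [hE2 i k (by omega), zero_mul]
      · rw [hE1 i k (by omega), zero_mul]
    · simp
  suffices hD : E = rectDiagonal r c p by rw [← hD]; exact hUE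
  ext i j
  simp only [rectDiagonal, Matrix.of_apply]
  split_ifs with hij
  · rw [hE3 i j hij, hp i j hij]
  · rcases lt_or_gt_of_ne hij with hlt | hlt
    · exact hE1 i j hlt
    · exact hE2 i j hlt

/-- The bidiagonal factorization given by the Neville eliminations of `A` and of its transpose. -/
theorem NevilleRegular.factorization {r c l n : ℕ} {A : Matrix (Fin r) (Fin c) ℝ}
    (hA : NevilleRegular A) (hA' : NevilleRegular A.transpose) (hl : r ≤ l + 1)
    (hn : c ≤ n + 1) :
    A = prodDown (fun i => bidiagonal r (nevilleMultiplier A) i) l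
        * rectDiagonal r c (fun i => nevillePivot A i i)
        * prodUp (fun i => (bidiagonal c (nevilleMultiplier A.transpose) i).transpose) n := by
  have h1 := hA.eq_prodDown_mul_upper hl
  have h2 := hA'.eq_prodDown_mul_upper hn
  rw [← transpose_prodDown, Matrix.mul_assoc, ← upper_eq_rectDiagonal_mul
    (isUnitLower_prodDown r (nevilleMultiplier A) l)
    (isUnitLower_prodDown c (nevilleMultiplier A.transpose) n)
    hA.upper_eq_zero hA'.upper_eq_zero]
  · exact h1
  · rw [← h1, ← h2, Matrix.transpose_transpose]
  · intro i j hij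
    rw [hA.pivot_eq le_rfl i.isLt (by omega)]
    exact congrArg (nevilleStage A i i) (Fin.ext hij.symm)

theorem NevilleRegular.det_eq {r : ℕ} {A : Matrix (Fin r) (Fin r) ℝ}
    (hA : NevilleRegular A) : A.det = ∏ i : Fin r, nevilleStage A i i i := by
  have h := congrArg Matrix.det (hA.eq_prodDown_mul_upper (Nat.le_succ r))
  rw [Matrix.det_mul, (isUnitLower_prodDown _ _ _).det_eq_one, one_mul] at h
  rw [h, Matrix.det_of_isUpperTriangular fun i j hij => hA.upper_eq_zero i j hij]
  rfl

/-! ### Neville elimination of matrices of Cauchy type -/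

/-- The matrix with the entries `w_i v_j / (a_i - b_j)` (indices from `0`). -/
noncomputable def cauchyLike (r c : ℕ) (a b w v : ℕ → ℝ) : Matrix (Fin r) (Fin c) ℝ :=
  Matrix.of fun i j => w i * v j / (a i - b j)

/-- The hypotheses on the nodes and weights of a matrix of Cauchy type under which its Neville
elimination needs no row moves. -/
structure CauchyData (r c : ℕ) (a b w v : ℕ → ℝ) : Prop where
  row_ne : ∀ i j, i < j → j < r → a i - a j ≠ 0
  col_ne : ∀ i j, i < j → j < c → b j - b i ≠ 0
  row_col_ne : ∀ i j, i < r → j < c → a i - b j ≠ 0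
  row_weight_ne : ∀ i, i < r → w i ≠ 0
  col_weight_ne : ∀ j, j < c → v j ≠ 0

/-- The entry in row `i` and column `j` after `k ≤ i` elimination steps (indices from `0`). -/
noncomputable def cauchyStage (a b w v : ℕ → ℝ) (k i j : ℕ) : ℝ :=
  w i * v j * (∏ s ∈ range k, (b j - b s)) * (∏ s ∈ Ico (i - k) i, (a s - a i)) /
    ((∏ s ∈ range k, (a i - b s)) * ∏ s ∈ Ico (i - k) (i + 1), (a s - b j))

section Cauchy

variable {r c : ℕ} {a b w v : ℕ → ℝ}

theorem CauchyData.prod_row_ne (h : CauchyData r c a b w v) {i m : ℕ} (hi : i < r) :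
    ∏ s ∈ Ico m i, (a s - a i) ≠ 0 :=
  prod_ne_zero_iff.2 fun s hs => h.row_ne s i (mem_Ico.1 hs).2 hi

theorem CauchyData.prod_col_ne (h : CauchyData r c a b w v) {j : ℕ} (hj : j < c) :
    ∏ s ∈ range j, (b j - b s) ≠ 0 :=
  prod_ne_zero_iff.2 fun s hs => h.col_ne s j (mem_range.1 hs) hj

theorem CauchyData.prod_range_ne (h : CauchyData r c a b w v) {i k : ℕ} (hi : i < r)
    (hk : k ≤ c) : ∏ s ∈ range k, (a i - b s) ≠ 0 :=
  prod_ne_zero_iff.2 fun s hs => h.row_col_ne i s hi ((mem_range.1 hs).trans_le hk)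

theorem CauchyData.prod_Ico_ne (h : CauchyData r c a b w v) {m i j : ℕ} (hi : i ≤ r)
    (hj : j < c) : ∏ s ∈ Ico m i, (a s - b j) ≠ 0 :=
  prod_ne_zero_iff.2 fun s hs => h.row_col_ne s j ((mem_Ico.1 hs).2.trans_le hi) hj

theorem CauchyData.stage_ne_zero (h : CauchyData r c a b w v) {k i : ℕ} (hi : i < r)
    (hk : k < c) : cauchyStage a b w v k i k ≠ 0 :=
  div_ne_zero
    (mul_ne_zero (mul_ne_zero (mul_ne_zero (h.row_weight_ne i hi) (h.col_weight_ne k hk))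
      (h.prod_col_ne hk)) (h.prod_row_ne hi))
    (mul_ne_zero (h.prod_range_ne hi hk.le) (h.prod_Ico_ne hi hk))

/-- The windows of row nodes for rows `m` and `m + 1` overlap; of the factors `a s - b k` only those
at the two ends, `s = m - k` and `s = m + 1`, survive. -/
theorem CauchyData.stage_div (h : CauchyData r c a b w v) {k m : ℕ} (hk : k < c) (hkm : k ≤ m)
    (hm : m + 1 < r) :
    cauchyStage a b w v k (m + 1) k / cauchyStage a b w v k m k =
      w (m + 1) * (∏ s ∈ Ico (m + 1 - k) (m + 1), (a s - a (m + 1))) *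
          (∏ s ∈ range k, (a m - b s)) * (a (m - k) - b k) /
        (w m * (∏ s ∈ Ico (m - k) m, (a s - a m)) * (∏ s ∈ range k, (a (m + 1) - b s)) *
          (a (m + 1) - b k)) := by
  have e : m + 1 - k = m - k + 1 := by omega
  have hR := h.prod_Ico_ne (m := m - k + 1) (show m + 1 ≤ r by omega) hk
  have hT := h.prod_row_ne (m := m - k) (show m < r by omega)
  have hB := h.prod_col_ne hk
  have hQ := h.prod_range_ne hm hk.le
  have hQ' := h.prod_range_ne (show m < r by omega) hk.le
  have h1 := h.row_col_ne (m - k) k (by omega) hk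
  have h2 := h.row_col_ne (m + 1) k hm hk
  have hw := h.row_weight_ne m (by omega)
  have hv := h.col_weight_ne k hk
  simp only [cauchyStage]
  rw [e, prod_Ico_succ_top (show m - k + 1 ≤ m + 1 by omega) (fun s => a s - b k),
    prod_eq_prod_Ico_succ_bot (show m - k < m + 1 by omega) (fun s => a s - b k)]
  field_simp

/-- With `p = a (m - k)` and `q = a (m + 1)`, cancelling common factors leaves `(q - b k) (p - b j)
- (p - b k) (q - b j) = (b j - b k) (p - q)`. -/
theorem CauchyData.stage_succ (h : CauchyData r c a b w v) {k m j : ℕ} (hk : k < c)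
    (hkm : k ≤ m) (hm : m + 1 < r) (hj : j < c) :
    cauchyStage a b w v (k + 1) (m + 1) j = cauchyStage a b w v k (m + 1) j -
      cauchyStage a b w v k (m + 1) k / cauchyStage a b w v k m k *
        cauchyStage a b w v k m j := by
  rw [h.stage_div hk hkm hm]
  have e : m + 1 - k = m - k + 1 := by omega
  have hR := h.prod_Ico_ne (m := m - k + 1) (show m + 1 ≤ r by omega) hj
  have hT := h.prod_row_ne (m := m - k) (show m < r by omega)
  have hQ := h.prod_range_ne hm hk.le
  have hQ' := h.prod_range_ne (show m < r by omega) hk.le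
  have h1 := h.row_col_ne (m - k) j (by omega) hj
  have h2 := h.row_col_ne (m + 1) k hm hk
  have h3 := h.row_col_ne (m + 1) j hm hj
  have hw := h.row_weight_ne m (by omega)
  simp only [cauchyStage]
  rw [e, Nat.add_sub_add_right, prod_range_succ, prod_range_succ,
    prod_Ico_succ_top (show m - k ≤ m + 1 by omega) (fun s => a s - b j),
    prod_Ico_succ_top (show m - k + 1 ≤ m + 1 by omega) (fun s => a s - b j),
    prod_eq_prod_Ico_succ_bot (show m - k < m + 1 by omega) (fun s => a s - b j),
    prod_eq_prod_Ico_succ_bot (show m - k < m + 1 by omega) (fun s => a s - a (m + 1))]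
  field_simp
  ring

/-- Row `i` is modified only in the first `i` steps, hence the `min`. The formula at stage `k`
supplies the nonzero column that makes the next reordering trivial. -/
theorem CauchyData.nevilleStage_eq (h : CauchyData r c a b w v) {k : ℕ} (hk : k ≤ c) (i : Fin r)
    (j : Fin c) :
    nevilleStage (cauchyLike r c a b w v) k i j = cauchyStage a b w v (min k i) i j := by
  induction k generalizing i j with
  | zero => simp [nevilleStage, cauchyLike, cauchyStage]
  | succ k ih =>
    have hk' : k < c := hk
    have ih' := ih hk'.le
    rw [nevilleStage, dif_pos hk', nevilleReorder_eq_self]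
    · simp only [nevilleEliminate, Matrix.of_apply, ih']
      split_ifs with hki
      · obtain ⟨i, hi⟩ := i
        obtain ⟨m, rfl⟩ : ∃ m, i = m + 1 := ⟨i - 1, by simp only at hki; omega⟩
        simp only at hki ⊢
        rw [show m + 1 - 1 = m by omega, min_eq_left (by omega), min_eq_left (by omega),
          min_eq_left (by omega), h.stage_succ hk' (by omega) hi j.isLt]
      · rw [show min k i.val = min (k + 1) i.val by omega]
    · intro i hi
      rw [ih', min_eq_left hi]
      exact h.stage_ne_zero i.isLt hk'

theorem CauchyData.nevilleRegular (h : CauchyData r c a b w v) :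
    NevilleRegular (cauchyLike r c a b w v) := by
  intro k i hki
  rw [h.nevilleStage_eq k.isLt.le, min_eq_left hki]
  exact h.stage_ne_zero i.isLt k.isLt

theorem CauchyData.nevillePivot_eq (h : CauchyData r c a b w v) {i k : ℕ} (hki : k ≤ i)
    (hi : i < r) (hk : k < c) :
    nevillePivot (cauchyLike r c a b w v) (i + 1) (k + 1) = cauchyStage a b w v k i k := by
  rw [h.nevilleRegular.pivot_eq hki hi hk, h.nevilleStage_eq hk.le, min_eq_left hki]

theorem CauchyData.nevilleMultiplier_eq (h : CauchyData r c a b w v) {k m : ℕ} (hk : k < c)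
    (hkm : k ≤ m) (hm : m + 1 < r) :
    nevilleMultiplier (cauchyLike r c a b w v) (m + 2) (k + 1) =
      w (m + 1) * (∏ s ∈ Ico (m + 1 - k) (m + 1), (a s - a (m + 1))) *
          (∏ s ∈ range k, (a m - b s)) * (a (m - k) - b k) /
        (w m * (∏ s ∈ Ico (m - k) m, (a s - a m)) * (∏ s ∈ range k, (a (m + 1) - b s)) *
          (a (m + 1) - b k)) := by
  rw [nevilleMultiplier, if_pos (by omega), show m + 2 - 1 = m + 1 by omega,
    h.nevillePivot_eq (by omega) hm hk, h.nevillePivot_eq hkm (by omega) hk,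
    h.stage_div hk hkm hm]

end Cauchy

/-- A square matrix of Cauchy type with positive weights, decreasing row nodes and increasing
column nodes, all row nodes being above the column nodes, has positive determinant. -/
theorem det_cauchyLike_pos {k : ℕ} {a b w v : ℕ → ℝ} (ha : ∀ i j, i < j → j < k → a j < a i)
    (hb : ∀ i j, i < j → j < k → b i < b j) (hab : ∀ i j, i < k → j < k → b j < a i)
    (hw : ∀ i, i < k → 0 < w i) (hv : ∀ j, j < k → 0 < v j) :
    0 < (cauchyLike k k a b w v).det := by
  have h : CauchyData k k a b w v :=
    ⟨fun i j hij hj => (sub_pos.2 (ha i j hij hj)).ne',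
      fun i j hij hj => (sub_pos.2 (hb i j hij hj)).ne',
      fun i j hi hj => (sub_pos.2 (hab i j hi hj)).ne',
      fun i hi => (hw i hi).ne', fun j hj => (hv j hj).ne'⟩
  rw [h.nevilleRegular.det_eq]
  refine prod_pos fun i _ => ?_
  have hi := i.isLt
  rw [h.nevilleStage_eq hi.le, min_self, cauchyStage]
  refine div_pos (mul_pos (mul_pos (mul_pos (hw i hi) (hv i hi)) ?_) ?_) (mul_pos ?_ ?_)
  · exact prod_pos fun s hs => sub_pos.2 (hb s i (mem_range.1 hs) hi)
  · exact prod_pos fun s hs => sub_pos.2 (ha s i (mem_Ico.1 hs).2 hi)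
  · exact prod_pos fun s hs => sub_pos.2 (hab i s hi ((mem_range.1 hs).trans hi))
  · exact prod_pos fun s hs => sub_pos.2 (hab s i (by have := (mem_Ico.1 hs).2; omega) hi)

theorem isSTP_cauchyLike {r c : ℕ} {a b w v : ℕ → ℝ} (ha : ∀ i j, i < j → j < r → a j < a i)
    (hb : ∀ i j, i < j → j < c → b i < b j) (hab : ∀ i j, i < r → j < c → b j < a i)
    (hw : ∀ i, i < r → 0 < w i) (hv : ∀ j, j < c → 0 < v j) :
    IsSTP (cauchyLike r c a b w v) := by
  intro k f g
  -- Nodes are indexed by `ℕ`, so the row and column selections are extended by a junk value `0`;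
  -- the minor is then of Cauchy type for the composed sequences.
  obtain ⟨F, hF⟩ : ∃ F : ℕ → ℕ, ∀ i : Fin k, F i = f i :=
    ⟨fun i => if h : i < k then f ⟨i, h⟩ else 0, fun i => by simp⟩
  obtain ⟨G, hG⟩ : ∃ G : ℕ → ℕ, ∀ i : Fin k, G i = g i :=
    ⟨fun i => if h : i < k then g ⟨i, h⟩ else 0, fun i => by simp⟩
  have hFr : ∀ i, i < k → F i < r := fun i hi => hF ⟨i, hi⟩ ▸ (f ⟨i, hi⟩).isLt
  have hGc : ∀ i, i < k → G i < c := fun i hi => hG ⟨i, hi⟩ ▸ (g ⟨i, hi⟩).isLt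
  have hFm : ∀ i j, i < j → j < k → F i < F j := fun i j hij hj => by
    rw [hF ⟨i, hij.trans hj⟩, hF ⟨j, hj⟩]
    exact f.strictMono (show (⟨i, hij.trans hj⟩ : Fin k) < ⟨j, hj⟩ from hij)
  have hGm : ∀ i j, i < j → j < k → G i < G j := fun i j hij hj => by
    rw [hG ⟨i, hij.trans hj⟩, hG ⟨j, hj⟩]
    exact g.strictMono (show (⟨i, hij.trans hj⟩ : Fin k) < ⟨j, hj⟩ from hij)
  have e : (cauchyLike r c a b w v).submatrix f g =
      cauchyLike k k (a ∘ F) (b ∘ G) (w ∘ F) (v ∘ G) := by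
    ext i j
    simp [cauchyLike, hF, hG]
  rw [e]
  exact det_cauchyLike_pos (fun i j hij hj => ha _ _ (hFm i j hij hj) (hFr j hj))
    (fun i j hij hj => hb _ _ (hGm i j hij hj) (hGc j hj))
    (fun i j hi hj => hab _ _ (hFr i hi) (hGc j hj)) (fun i hi => hw _ (hFr i hi))
    (fun j hj => hv _ (hGc j hj))

/-! ### The Lagrange-Vandermonde matrix -/

theorem prod_Ico_shift (f : ℕ → ℝ) (p q : ℕ) :
    ∏ s ∈ Ico p q, f (s + 1) = ∏ k ∈ Icc (p + 1) q, f k := by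
  rw [prod_Ico_add' f p q 1]
  exact prod_congr (by ext; simp) fun _ _ => rfl

theorem prod_range_shift (f : ℕ → ℝ) (q : ℕ) :
    ∏ s ∈ range q, f (s + 1) = ∏ k ∈ Icc 1 q, f k := by
  rw [range_eq_Ico, prod_Ico_shift]

theorem prod_Icc_split (f : ℕ → ℝ) {k n : ℕ} (hk : k ≤ n) :
    ∏ s ∈ Icc 1 n, f s = (∏ s ∈ Icc 1 k, f s) * ∏ s ∈ Icc (k + 1) n, f s := by
  rw [← prod_Ico_shift, ← prod_Ico_shift, ← prod_Ico_shift,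
    prod_Ico_consecutive _ (Nat.zero_le k) hk]

theorem prod_Icc_succ_bot (f : ℕ → ℝ) {k n : ℕ} (hk : k + 1 ≤ n) :
    ∏ s ∈ Icc (k + 1) n, f s = f (k + 1) * ∏ s ∈ Icc (k + 2) n, f s := by
  rw [← prod_Ico_shift, ← prod_Ico_shift, prod_eq_prod_Ico_succ_bot hk]

theorem prod_Icc_sub_comm (f : ℕ → ℝ) (y : ℝ) (p q : ℕ) :
    ∏ s ∈ Icc p q, (f s - y) = (-1) ^ (q + 1 - p) * ∏ s ∈ Icc p q, (y - f s) := by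
  rw [← Nat.card_Icc, ← prod_const, ← prod_mul_distrib]
  exact prod_congr rfl fun _ _ => by ring

/-- The nodal polynomial of `x_1, …, x_{n+1}` at `t_{i+1}`. -/
noncomputable def nodal (n : ℕ) (x t : ℕ → ℝ) (i : ℕ) : ℝ :=
  ∏ k ∈ Icc 1 (n + 1), (t (i + 1) - x k)

section Nodes

variable {l n : ℕ} {x t : ℕ → ℝ}

theorem col_node_lt_row_node (hx : StrictMonoOn x (Set.Icc 1 (n + 1)))
    (ht : StrictAntiOn t (Set.Icc 1 (l + 1))) (hxt : x (n + 1) < t (l + 1)) {i j : ℕ}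
    (hi : i ∈ Set.Icc 1 (l + 1)) (hj : j ∈ Set.Icc 1 (n + 1)) : x j < t i :=
  ((hx.monotoneOn hj ⟨by omega, le_rfl⟩ hj.2).trans_lt hxt).trans_le
    (ht.antitoneOn hi ⟨by omega, le_rfl⟩ hi.2)

theorem nodal_pos (hx : StrictMonoOn x (Set.Icc 1 (n + 1)))
    (ht : StrictAntiOn t (Set.Icc 1 (l + 1))) (hxt : x (n + 1) < t (l + 1)) {i : ℕ}
    (hi : i < l + 1) : 0 < nodal n x t i :=
  prod_pos fun k hk => sub_pos.2 <|
    col_node_lt_row_node hx ht hxt ⟨by omega, by omega⟩ (by simpa using hk)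

theorem lagrangeVandermonde_eq_cauchyLike (hx : StrictMonoOn x (Set.Icc 1 (n + 1)))
    (ht : StrictAntiOn t (Set.Icc 1 (l + 1))) (hxt : x (n + 1) < t (l + 1)) :
    lagrangeVandermonde l n x t = cauchyLike (l + 1) (n + 1) (fun i => t (i + 1))
      (fun j => x (j + 1)) (nodal n x t) (fun _ => 1) := by
  ext i j
  have hij : t (i.val + 1) - x (j.val + 1) ≠ 0 := (sub_pos.2 <| col_node_lt_row_node hx ht hxt
    ⟨by omega, by omega⟩ ⟨by omega, by omega⟩).ne'
  simp only [lagrangeVandermonde, cauchyLike, nodal, Matrix.of_apply, mul_one]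
  rw [eq_div_iff hij, prod_erase_mul _ _ (by simp; omega)]

/-- Negating the nodes keeps the denominators `t - x` while exchanging the roles of rows and
columns; the nodal weights move to the columns. -/
theorem transpose_lagrangeVandermonde_eq_cauchyLike (hx : StrictMonoOn x (Set.Icc 1 (n + 1)))
    (ht : StrictAntiOn t (Set.Icc 1 (l + 1))) (hxt : x (n + 1) < t (l + 1)) :
    (lagrangeVandermonde l n x t).transpose = cauchyLike (n + 1) (l + 1) (fun i => -x (i + 1))
      (fun j => -t (j + 1)) (fun _ => 1) (nodal n x t) := by
  rw [lagrangeVandermonde_eq_cauchyLike hx ht hxt]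
  ext i j
  simp only [Matrix.transpose_apply, cauchyLike, Matrix.of_apply]
  rw [mul_one, one_mul, neg_sub_neg]

theorem cauchyData_nodal (hx : StrictMonoOn x (Set.Icc 1 (n + 1)))
    (ht : StrictAntiOn t (Set.Icc 1 (l + 1))) (hxt : x (n + 1) < t (l + 1)) :
    CauchyData (l + 1) (n + 1) (fun i => t (i + 1)) (fun j => x (j + 1)) (nodal n x t)
      (fun _ => 1) where
  row_ne i j hij hj := (sub_pos.2 <|
    ht ⟨by omega, by omega⟩ ⟨by omega, by omega⟩ (by omega : i + 1 < j + 1)).ne'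
  col_ne i j hij hj := (sub_pos.2 <|
    hx ⟨by omega, by omega⟩ ⟨by omega, by omega⟩ (by omega : i + 1 < j + 1)).ne'
  row_col_ne i j hi hj := (sub_pos.2 <|
    col_node_lt_row_node hx ht hxt ⟨by omega, by omega⟩ ⟨by omega, by omega⟩).ne'
  row_weight_ne i hi := (nodal_pos hx ht hxt hi).ne'
  col_weight_ne _ _ := one_ne_zero

theorem cauchyData_neg_nodal (hx : StrictMonoOn x (Set.Icc 1 (n + 1)))
    (ht : StrictAntiOn t (Set.Icc 1 (l + 1))) (hxt : x (n + 1) < t (l + 1)) :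
    CauchyData (n + 1) (l + 1) (fun i => -x (i + 1)) (fun j => -t (j + 1)) (fun _ => 1)
      (nodal n x t) where
  row_ne i j hij hj := by
    rw [neg_sub_neg]; exact (cauchyData_nodal hx ht hxt).col_ne i j hij hj
  col_ne i j hij hj := by
    rw [neg_sub_neg]; exact (cauchyData_nodal hx ht hxt).row_ne i j hij hj
  row_col_ne i j hi hj := by
    rw [neg_sub_neg]; exact (cauchyData_nodal hx ht hxt).row_col_ne j i hj hi
  row_weight_ne _ _ := one_ne_zero
  col_weight_ne j hj := (nodal_pos hx ht hxt hj).ne'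

theorem isSTP_lagrangeVandermonde (hx : StrictMonoOn x (Set.Icc 1 (n + 1)))
    (ht : StrictAntiOn t (Set.Icc 1 (l + 1))) (hxt : x (n + 1) < t (l + 1)) :
    IsSTP (lagrangeVandermonde l n x t) := by
  rw [lagrangeVandermonde_eq_cauchyLike hx ht hxt]
  exact isSTP_cauchyLike
    (fun i j hij hj => ht ⟨by omega, by omega⟩ ⟨by omega, by omega⟩ (by omega))
    (fun i j hij hj => hx ⟨by omega, by omega⟩ ⟨by omega, by omega⟩ (by omega))
    (fun i j hi hj => col_node_lt_row_node hx ht hxt ⟨by omega, by omega⟩ ⟨by omega, by omega⟩)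
    (fun i hi => nodal_pos hx ht hxt hi) fun _ _ => one_pos

/-- The row weights are nodal products, whose leading factors cancel against the `t - x` products of
the Cauchy formula. Reversing the differences of the `t` nodes costs `(-1) ^ k` above and below. -/
theorem nevilleMultiplier_lagrangeVandermonde (hx : StrictMonoOn x (Set.Icc 1 (n + 1)))
    (ht : StrictAntiOn t (Set.Icc 1 (l + 1))) (hxt : x (n + 1) < t (l + 1)) {k m : ℕ}
    (hk : k < n + 1) (hkm : k ≤ m) (hm : m + 1 < l + 1) :
    nevilleMultiplier (lagrangeVandermonde l n x t) (m + 2) (k + 1) =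
      (t (m + 1 - k) - x (k + 1)) *
        (((∏ s ∈ Icc (m + 1 - k + 1) (m + 1), (t (m + 2) - t s)) *
            ∏ s ∈ Icc (k + 2) (n + 1), (t (m + 2) - x s)) /
          ((∏ s ∈ Icc (m + 1 - k) m, (t (m + 1) - t s)) *
            ∏ s ∈ Icc (k + 1) (n + 1), (t (m + 1) - x s))) := by
  have h := cauchyData_nodal hx ht hxt
  have hw := h.row_weight_ne m (by omega)
  have hQ := h.prod_range_ne hm hk.le
  have hr := h.row_col_ne (m + 1) k hm hk
  have hT := h.prod_row_ne (m := m - k) (show m < l + 1 by omega)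
  rw [lagrangeVandermonde_eq_cauchyLike hx ht hxt, h.nevilleMultiplier_eq hk hkm hm]
  simp only [nodal] at hw ⊢
  rw [prod_Ico_shift (fun s => t s - t (m + 1 + 1)), prod_Ico_shift (fun s => t s - t (m + 1)),
    prod_range_shift (fun s => t (m + 1) - x s), prod_range_shift (fun s => t (m + 1 + 1) - x s),
    prod_Icc_split (fun s => t (m + 1) - x s) hk.le,
    prod_Icc_split (fun s => t (m + 1 + 1) - x s) hk.le,
    prod_Icc_succ_bot (fun s => t (m + 1 + 1) - x s) hk,
    prod_Icc_sub_comm t, prod_Icc_sub_comm t,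
    show m + 1 + 1 - (m + 1 - k + 1) = k by omega, show m + 1 - (m - k + 1) = k by omega,
    show m - k + 1 = m + 1 - k by omega]
  rw [prod_range_shift (fun s => t (m + 1 + 1) - x s)] at hQ
  rw [prod_Icc_split (fun s => t (m + 1) - x s) hk.le] at hw
  rw [prod_Ico_shift (fun s => t s - t (m + 1)), prod_Icc_sub_comm t,
    show m - k + 1 = m + 1 - k by omega] at hT
  have hw1 := left_ne_zero_of_mul hw
  have hw2 := right_ne_zero_of_mul hw
  have hT := right_ne_zero_of_mul hT
  have h1 : ((-1 : ℝ)) ^ k ≠ 0 := pow_ne_zero _ (by norm_num)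
  field_simp

/-- The row weights are now `1`, so nothing cancels; the lone factor `t (k + 1) - x (m + 2)` extends
the denominator product to `k + 1`. -/
theorem nevilleMultiplier_transpose_lagrangeVandermonde (hx : StrictMonoOn x (Set.Icc 1 (n + 1)))
    (ht : StrictAntiOn t (Set.Icc 1 (l + 1))) (hxt : x (n + 1) < t (l + 1)) {k m : ℕ}
    (hk : k < l + 1) (hkm : k ≤ m) (hm : m + 1 < n + 1) :
    nevilleMultiplier (lagrangeVandermonde l n x t).transpose (m + 2) (k + 1) =
      (t (k + 1) - x (m + 1 - k)) *
        (((∏ s ∈ Icc (m + 1 - k + 1) (m + 1), (x (m + 2) - x s)) *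
            ∏ s ∈ Icc 1 k, (t s - x (m + 1))) /
          ((∏ s ∈ Icc (m + 1 - k) m, (x (m + 1) - x s)) *
            ∏ s ∈ Icc 1 (k + 1), (t s - x (m + 2)))) := by
  rw [transpose_lagrangeVandermonde_eq_cauchyLike hx ht hxt,
    (cauchyData_neg_nodal hx ht hxt).nevilleMultiplier_eq hk hkm hm]
  simp only [neg_sub_neg]
  rw [prod_Ico_shift (fun s => x (m + 1 + 1) - x s), prod_Ico_shift (fun s => x (m + 1) - x s),
    prod_range_shift (fun s => t s - x (m + 1)), prod_range_shift (fun s => t s - x (m + 1 + 1)),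
    ← prod_range_shift _ (k + 1), prod_range_succ,
    prod_range_shift (fun s => t s - x (m + 2)), show m - k + 1 = m + 1 - k by omega]
  ring

/-- The first `m` factors of the nodal weight cancel the column-node product, and the next one
cancels the diagonal factor `t (m + 1) - x (m + 1)`. -/
theorem nevillePivot_lagrangeVandermonde (hln : n ≤ l) (hx : StrictMonoOn x (Set.Icc 1 (n + 1)))
    (ht : StrictAntiOn t (Set.Icc 1 (l + 1))) (hxt : x (n + 1) < t (l + 1)) {m : ℕ}
    (hm : m < n + 1) :
    nevillePivot (lagrangeVandermonde l n x t) (m + 1) (m + 1) =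
      ((∏ s ∈ Icc 1 m, (t s - t (m + 1))) * (∏ s ∈ Icc 1 m, (x (m + 1) - x s)) *
          ∏ s ∈ Icc (m + 2) (n + 1), (t (m + 1) - x s)) /
        ∏ s ∈ Icc 1 m, (t s - x (m + 1)) := by
  have h := cauchyData_nodal hx ht hxt
  have hQ := h.prod_range_ne (show m < l + 1 by omega) hm.le
  have hr := h.row_col_ne m m (by omega) hm
  have hR := h.prod_Ico_ne (m := 0) (show m ≤ l + 1 by omega) hm
  rw [lagrangeVandermonde_eq_cauchyLike hx ht hxt, h.nevillePivot_eq le_rfl (by omega) hm,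
    cauchyStage, Nat.sub_self, prod_Ico_succ_top (Nat.zero_le m), nodal,
    prod_Icc_split (fun s => t (m + 1) - x s) hm.le,
    prod_Icc_succ_bot (fun s => t (m + 1) - x s) hm]
  rw [prod_Ico_shift (fun s => t s - x (m + 1))] at hR ⊢
  rw [prod_range_shift (fun s => t (m + 1) - x s)] at hQ ⊢
  rw [prod_Ico_shift (fun s => t s - t (m + 1)), prod_range_shift (fun s => x (m + 1) - x s)]
  simp only [zero_add] at hR ⊢
  field_simp

end Nodes

end LagrangeVandermonde

theorem theorem1 (l n : ℕ) (hln : n ≤ l) (x t : ℕ → ℝ)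
    (hx : StrictMonoOn x (Set.Icc 1 (n + 1)))
    (ht : StrictAntiOn t (Set.Icc 1 (l + 1)))
    (hxt : x (n + 1) < t (l + 1))
    (A : Matrix (Fin (l + 1)) (Fin (n + 1)) ℝ)
    (hA : A = LagrangeVandermonde.lagrangeVandermonde l n x t) :
    LagrangeVandermonde.IsSTP A ∧
    A = LagrangeVandermonde.prodDown
          (fun i => LagrangeVandermonde.bidiagonal (l + 1)
            (LagrangeVandermonde.nevilleMultiplier A) i) l
        * LagrangeVandermonde.rectDiagonal (l + 1) (n + 1)
            (fun i => LagrangeVandermonde.nevillePivot A i i)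
        * LagrangeVandermonde.prodUp
          (fun i => (LagrangeVandermonde.bidiagonal (n + 1)
            (LagrangeVandermonde.nevilleMultiplier A.transpose) i).transpose) n ∧
    (∀ i j : ℕ, 1 ≤ j → j ≤ n + 1 → j + 1 ≤ i → i ≤ l + 1 →
      LagrangeVandermonde.nevilleMultiplier A i j =
        (t (i - j) - x j) *
          (((∏ k ∈ Finset.Icc (i - j + 1) (i - 1), (t i - t k)) *
              ∏ k ∈ Finset.Icc (j + 1) (n + 1), (t i - x k)) /
            ((∏ k ∈ Finset.Icc (i - j) (i - 2), (t (i - 1) - t k)) *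
              ∏ k ∈ Finset.Icc j (n + 1), (t (i - 1) - x k)))) ∧
    (∀ i j : ℕ, 1 ≤ j → j ≤ n → j + 1 ≤ i → i ≤ n + 1 →
      LagrangeVandermonde.nevilleMultiplier A.transpose i j =
        (t j - x (i - j)) *
          (((∏ k ∈ Finset.Icc (i - j + 1) (i - 1), (x i - x k)) *
              ∏ k ∈ Finset.Icc 1 (j - 1), (t k - x (i - 1))) /
            ((∏ k ∈ Finset.Icc (i - j) (i - 2), (x (i - 1) - x k)) *
              ∏ k ∈ Finset.Icc 1 j, (t k - x i)))) ∧
    (∀ i : ℕ, 1 ≤ i → i ≤ n + 1 →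
      LagrangeVandermonde.nevillePivot A i i =
        ((∏ k ∈ Finset.Icc 1 (i - 1), (t k - t i)) *
            (∏ k ∈ Finset.Icc 1 (i - 1), (x i - x k)) *
            ∏ k ∈ Finset.Icc (i + 1) (n + 1), (t i - x k)) /
          ∏ k ∈ Finset.Icc 1 (i - 1), (t k - x i)) := by

  subst hA
  have h1 := LagrangeVandermonde.lagrangeVandermonde_eq_cauchyLike hx ht hxt
  have h2 := LagrangeVandermonde.transpose_lagrangeVandermonde_eq_cauchyLike hx ht hxt
  have r1 := (LagrangeVandermonde.cauchyData_nodal hx ht hxt).nevilleRegular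
  have r2 := (LagrangeVandermonde.cauchyData_neg_nodal hx ht hxt).nevilleRegular
  rw [← h1] at r1
  rw [← h2] at r2
  refine ⟨LagrangeVandermonde.isSTP_lagrangeVandermonde hx ht hxt,
    r1.factorization r2 le_rfl le_rfl, ?_, ?_, ?_⟩
  · intro i j hj hjn hji hi
    obtain ⟨k, rfl⟩ : ∃ k, j = k + 1 := ⟨j - 1, by omega⟩
    obtain ⟨m, rfl⟩ : ∃ m, i = m + 2 := ⟨i - 2, by omega⟩
    rw [LagrangeVandermonde.nevilleMultiplier_lagrangeVandermonde hx ht hxt (by omega) (by omega)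
      (by omega), show m + 2 - (k + 1) = m + 1 - k by omega]
    rfl
  · intro i j hj hjn hji hi
    obtain ⟨k, rfl⟩ : ∃ k, j = k + 1 := ⟨j - 1, by omega⟩
    obtain ⟨m, rfl⟩ : ∃ m, i = m + 2 := ⟨i - 2, by omega⟩
    rw [LagrangeVandermonde.nevilleMultiplier_transpose_lagrangeVandermonde hx ht hxt (by omega)
      (by omega) (by omega), show m + 2 - (k + 1) = m + 1 - k by omega]
    rfl
  · intro i hi hin
    obtain ⟨m, rfl⟩ : ∃ m, i = m + 1 := ⟨i - 1, by omega⟩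
    exact LagrangeVandermonde.nevillePivot_lagrangeVandermonde hln hx ht hxt (by omega)
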